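/- Let $q\ge 0$ and $m,p\ge 1$ be integers, $n=q+m$, $\theta\in\mathbb R^{q\times p}$, $\Sigma\in\mathbb R^{p\times p}$ symmetric positive definite, and $f$ a measurable function, non-negative on $[0,\infty)$, such that $$(z,u)\mapsto |\Sigma|^{-n/2} f\big(\mathrm{tr}\,(z-\theta)\Sigma^{-1}(z-\theta)^\top+\mathrm{tr}\,u\Sigma^{-1}u^\top\big),\qquad z\in\mathbb R^{q\times p},\ u\in\mathbb R^{m\times p},$$ is a probability density with respect to Lebesgue measure. Let $(Z,U)$ have this density, let $E$ denote expectation under it, and put $S=U^\top U$, with Moore--Penrose inverse $S^+$. For an estimator $\hat\Sigma=\hat\Sigma(Z,U)$ of $\Sigma$, let the data-based loss be $L_S(\hat\Sigma,\Sigma)=\mathrm{tr}\big(S^+\Sigma(\Sigma^{-1}\hat\Sigma-I_p)^2\big)$ and the risk $R(\hat\Sigma,\Sigma)=E\,L_S(\hat\Sigma,\Sigma)$. Let $F^*(t)=\frac12\int_t^\infty f(\nu)\,d\nu$ for $t\ge0$, and $$K^*=\int |\Sigma|^{-n/2} F^*\big(\mathrm{tr}\,(z-\theta)\Sigma^{-1}(z-\theta)^\top+\mathrm{tr}\,u\Sigma^{-1}u^\top\big)\,dz\,du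 .$$ Assume that $K^*$, $E\,\mathrm{tr}(\Sigma^{-1}S)$ and $E\,\mathrm{tr}(\Sigma S^+)$ are finite. Put $r=\min\{p,m\}$ and $v=\max\{p,m\}$. Then $K^*>0$, $K^*$ does not depend on $(\theta,\Sigma)$, and for every $a>0$ the loss of $aS$ is integrable with $$R(aS,\Sigma)=a^2K^*rv-2ar+E\,\mathrm{tr}(S^+\Sigma).$$ Consequently $a_o=1/(K^*v)>0$ is the unique minimizer of $a\mapsto R(aS,\Sigma)$ over $a>0$. -/

import Mathlib

open MeasureTheory

namespace EllipticalScale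

section MoorePenrose

variable {k l : ℕ}

/-- `B` is a Moore-Penrose inverse of the real matrix `A`: the four Penrose conditions. -/
structure IsMoorePenrose (A : Matrix (Fin k) (Fin l) ℝ) (B : Matrix (Fin l) (Fin k) ℝ) :
    Prop where
  mul_mul_left : A * B * A = A
  mul_mul_right : B * A * B = B
  symm_left : (A * B).transpose = A * B
  symm_right : (B * A).transpose = B * A

theorem IsMoorePenrose.unique {A : Matrix (Fin k) (Fin l) ℝ} {B C : Matrix (Fin l) (Fin k) ℝ}
    (hB : IsMoorePenrose A B) (hC : IsMoorePenrose A C) : B = C := by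
  have h1 : A * B = A * C := by
    calc A * B = (A * B).transpose := hB.symm_left.symm
      _ = ((A * C) * (A * B)).transpose := by
          rw [← Matrix.mul_assoc (A * C) A B, hC.mul_mul_left]
      _ = (A * B) * (A * C) := by
          rw [Matrix.transpose_mul, hB.symm_left, hC.symm_left]
      _ = A * C := by rw [← Matrix.mul_assoc (A * B) A C, hB.mul_mul_left]
  have h2 : B * A = C * A := by
    calc B * A = (B * A).transpose := hB.symm_right.symm
      _ = ((B * A) * (C * A)).transpose := by
          rw [Matrix.mul_assoc B A (C * A), ← Matrix.mul_assoc A C A, hC.mul_mul_left]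
      _ = (C * A) * (B * A) := by
          rw [Matrix.transpose_mul, hB.symm_right, hC.symm_right]
      _ = C * A := by rw [Matrix.mul_assoc C A (B * A), ← Matrix.mul_assoc A B A, hB.mul_mul_left]
  calc B = B * A * B := hB.mul_mul_right.symm
    _ = C * (A * B) := by rw [h2, Matrix.mul_assoc]
    _ = C * A * C := by rw [h1, Matrix.mul_assoc]
    _ = C := hC.mul_mul_right

theorem exists_isMoorePenrose_of_isHermitian (A : Matrix (Fin k) (Fin k) ℝ)
    (hA : A.IsHermitian) : ∃ B, IsMoorePenrose A B := by
  have key : ∃ (U : Matrix (Fin k) (Fin k) ℝ) (d : Fin k → ℝ),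
      U.transpose * U = 1 ∧ A = U * Matrix.diagonal d * U.transpose := by
    refine ⟨hA.eigenvectorUnitary, hA.eigenvalues, ?_, ?_⟩
    · have h := Unitary.coe_star_mul_self hA.eigenvectorUnitary
      rw [Matrix.star_eq_conjTranspose, Matrix.conjTranspose_eq_transpose_of_trivial] at h
      exact h
    · have h := hA.spectral_theorem
      rw [Unitary.conjStarAlgAut_apply, Matrix.star_eq_conjTranspose,
        Matrix.conjTranspose_eq_transpose_of_trivial] at h
      exact h
  obtain ⟨U, d, hU, hAd⟩ := key
  have mm : ∀ x y : Fin k → ℝ,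
      (U * Matrix.diagonal x * U.transpose) * (U * Matrix.diagonal y * U.transpose)
        = U * Matrix.diagonal (fun i => x i * y i) * U.transpose := by
    intro x y
    calc _ = U * Matrix.diagonal x * (U.transpose * U) * Matrix.diagonal y * U.transpose := by
            simp only [Matrix.mul_assoc]
      _ = _ := by
            rw [hU, Matrix.mul_one, Matrix.mul_assoc U, Matrix.diagonal_mul_diagonal]
  have tt : ∀ x : Fin k → ℝ, (U * Matrix.diagonal x * U.transpose).transpose
      = U * Matrix.diagonal x * U.transpose := by
    intro x
    simp [Matrix.transpose_mul, Matrix.mul_assoc]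
  refine ⟨U * Matrix.diagonal (fun i => (d i)⁻¹) * U.transpose, ?_⟩
  subst hAd
  refine ⟨?_, ?_, ?_, ?_⟩
  · rw [mm, mm]
    congr 3
    funext i
    exact mul_inv_mul_cancel (d i)
  · rw [mm, mm]
    congr 3
    funext i
    by_cases h : d i = 0
    · simp [h]
    · rw [inv_mul_cancel₀ h, one_mul]
  · rw [mm, tt]
  · rw [mm, tt]

theorem IsMoorePenrose.transpose_of_symm {A C : Matrix (Fin k) (Fin k) ℝ}
    (hC : IsMoorePenrose A C) (hS : A.transpose = A) : IsMoorePenrose A C.transpose := by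
  have h1 : A * C.transpose = C * A := by
    rw [← hC.symm_right, Matrix.transpose_mul, hS]
  have h2 : C.transpose * A = A * C := by
    rw [← hC.symm_left, Matrix.transpose_mul, hS]
  refine ⟨?_, ?_, ?_, ?_⟩
  · rw [Matrix.mul_assoc, h2, ← Matrix.mul_assoc]
    have h := congrArg Matrix.transpose hC.mul_mul_left
    rwa [Matrix.transpose_mul, hC.symm_left.symm, Matrix.transpose_transpose, hS,
      ← Matrix.mul_assoc] at h
  · have h := congrArg Matrix.transpose hC.mul_mul_right
    rwa [Matrix.transpose_mul, Matrix.transpose_mul, hS, ← Matrix.mul_assoc] at h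
  · rw [h1, hC.symm_right]
  · rw [h2, hC.symm_left]

theorem exists_isMoorePenrose (A : Matrix (Fin k) (Fin l) ℝ) : ∃ B, IsMoorePenrose A B := by
  obtain ⟨C, hC⟩ := exists_isMoorePenrose_of_isHermitian (A.transpose * A) (by
    simpa using Matrix.isHermitian_conjTranspose_mul_self A)
  have hS : (A.transpose * A).transpose = A.transpose * A := by
    simp [Matrix.transpose_mul]
  have hsym : C.transpose = C := (hC.transpose_of_symm hS).unique hC
  have hA : A * (C * A.transpose) * A = A := by
    have h : A.transpose * A * (C * (A.transpose * A) - 1) = 0 := by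
      rw [Matrix.mul_sub, ← Matrix.mul_assoc, hC.mul_mul_left, Matrix.mul_one, sub_self]
    have h' := (Matrix.conjTranspose_mul_self_mul_eq_zero A _).1
      (by rwa [Matrix.conjTranspose_eq_transpose_of_trivial])
    rw [Matrix.mul_sub, Matrix.mul_one, sub_eq_zero] at h'
    simpa only [Matrix.mul_assoc] using h'
  refine ⟨C * A.transpose, hA, ?_, ?_, ?_⟩
  · have h := congrArg (fun M => M * A.transpose) hC.mul_mul_right
    simpa only [Matrix.mul_assoc] using h
  · simp [Matrix.transpose_mul, hsym, Matrix.mul_assoc]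
  · have h := hC.symm_right
    simpa only [Matrix.mul_assoc] using h

/-- The Moore-Penrose inverse `A⁺` of a real matrix. -/
noncomputable def pinv (A : Matrix (Fin k) (Fin l) ℝ) : Matrix (Fin l) (Fin k) ℝ :=
  Classical.choose (exists_isMoorePenrose A)

theorem isMoorePenrose_pinv (A : Matrix (Fin k) (Fin l) ℝ) : IsMoorePenrose A (pinv A) :=
  Classical.choose_spec (exists_isMoorePenrose A)

end MoorePenrose

section Model

variable {q m p : ℕ}

/-- The space `ℝ^{q × p} × ℝ^{m × p}` of the observations `(z, u)`, with its product Lebesgue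
measure. -/
abbrev Obs (q m p : ℕ) : Type := (Fin q → Fin p → ℝ) × (Fin m → Fin p → ℝ)

/-- The block `z` as a `q × p` matrix. -/
def zMat (x : Obs q m p) : Matrix (Fin q) (Fin p) ℝ := Matrix.of x.1

/-- The block `u` as an `m × p` matrix. -/
def uMat (x : Obs q m p) : Matrix (Fin m) (Fin p) ℝ := Matrix.of x.2

/-- `tr (z - θ) Σ⁻¹ (z - θ)ᵀ + tr u Σ⁻¹ uᵀ`, where `Sig` stands for `Σ`. -/
noncomputable def quadForm (θ : Matrix (Fin q) (Fin p) ℝ) (Sig : Matrix (Fin p) (Fin p) ℝ)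
    (x : Obs q m p) : ℝ :=
  Matrix.trace ((zMat x - θ) * Sig⁻¹ * (zMat x - θ).transpose)
    + Matrix.trace (uMat x * Sig⁻¹ * (uMat x).transpose)

/-- `|Σ|^{-n/2}` with `n = q + m`. -/
noncomputable def detFactor (q m : ℕ) (Sig : Matrix (Fin p) (Fin p) ℝ) : ℝ :=
  Sig.det ^ (-((q + m : ℕ) : ℝ) / 2)

/-- The measure on the observations with density
`(z, u) ↦ |Σ|^{-n/2} f (tr (z - θ) Σ⁻¹ (z - θ)ᵀ + tr u Σ⁻¹ uᵀ)`. -/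
noncomputable def law (f : ℝ → ℝ) (θ : Matrix (Fin q) (Fin p) ℝ)
    (Sig : Matrix (Fin p) (Fin p) ℝ) : Measure (Obs q m p) :=
  volume.withDensity fun x => ENNReal.ofReal (detFactor q m Sig * f (quadForm θ Sig x))

/-- `F*(t) = (1/2) ∫_t^∞ f(ν) dν`, with values in `[0, ∞]`. -/
noncomputable def FStar (f : ℝ → ℝ) (t : ℝ) : ENNReal :=
  (1 / 2) * ∫⁻ ν in Set.Ioi t, ENNReal.ofReal (f ν)

/-- `K*`, the total mass, in `[0, ∞]`, of
`(z, u) ↦ |Σ|^{-n/2} F* (tr (z - θ) Σ⁻¹ (z - θ)ᵀ + tr u Σ⁻¹ uᵀ)`. -/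
noncomputable def KStar (m : ℕ) (f : ℝ → ℝ) (θ : Matrix (Fin q) (Fin p) ℝ)
    (Sig : Matrix (Fin p) (Fin p) ℝ) : ENNReal :=
  ∫⁻ x : Obs q m p, ENNReal.ofReal (detFactor q m Sig) * FStar f (quadForm θ Sig x)

/-- `S = UᵀU`. -/
def sampleCov (x : Obs q m p) : Matrix (Fin p) (Fin p) ℝ :=
  (uMat x).transpose * uMat x

/-- The data-based loss `tr (S⁺ Σ (Σ⁻¹ Σ̂ - I)²)`. -/
noncomputable def loss (S Sighat Sig : Matrix (Fin p) (Fin p) ℝ) : ℝ :=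
  Matrix.trace (pinv S * Sig * (Sig⁻¹ * Sighat - 1) ^ 2)

/-- The risk of an estimator `Σ̂ = est (z, u)` under the data-based loss. -/
noncomputable def risk (f : ℝ → ℝ) (θ : Matrix (Fin q) (Fin p) ℝ)
    (Sig : Matrix (Fin p) (Fin p) ℝ) (est : Obs q m p → Matrix (Fin p) (Fin p) ℝ) : ℝ :=
  ∫ x, loss (sampleCov x) (est x) Sig ∂(law f θ Sig)

end Model

end EllipticalScale

/-! Since `S * S⁺ * S = S`, the loss of `aS` expands to `a² tr(Σ⁻¹S) - 2a tr(S⁺S) + tr(S⁺Σ)`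
(`loss_smul_self`), so the risk is a quadratic in `a` and only two coefficients remain to be found.

The middle one is a rank: `S⁺S` is idempotent, hence `tr(S⁺S) = rank S`, which is almost surely `min
p m` because Lebesgue-almost every matrix has full rank (`ae_rank_eq_min`).

The leading one is the identity `E tr(Σ⁻¹S) = m p K*` (`lintegral_law_trace_inv_mul_sampleCov`).
Writing `Σ = AᵀA` and changing variables reduces it to `θ = 0`, `Σ = I`, where the trace is the sum
of the `m p` squares `u_ij²`. Each contributes `∫ u_ij² f(|x|²) dx = ∫ F*(|x|²) dx = K*`, by an
integration by parts in that one coordinate, done with Tonelli in `[0, ∞]`. The same reduction frees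
`K*` from the parameters. As `m p = r v`, completing the square finishes the proof. -/

namespace EllipticalScale

/-! ### One-dimensional integration by parts for `F*` -/

section IntegrationByParts

/-- Substitution `ν = s + t²` on one half-line: the Jacobian `2|t|` and `√(ν - s) = |t|` multiply to
`2t²`. -/
theorem lintegral_two_sqrt_eq (g : ℝ → ENNReal) (s : ℝ) (I : Set ℝ) (hI : MeasurableSet I)
    (hinj : Set.InjOn (fun t : ℝ => s + t ^ 2) I)
    (himg : (fun t : ℝ => s + t ^ 2) '' I = Set.Ioi s) :
    ∫⁻ ν in Set.Ioi s, ENNReal.ofReal √(ν - s) * g ν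
      = 2 * ∫⁻ t in I, ENNReal.ofReal (t ^ 2) * g (s + t ^ 2) := by
  rw [← himg, lintegral_image_eq_lintegral_abs_deriv_mul hI (f' := fun t => 2 * t)
    (fun t _ => by simpa using ((hasDerivAt_pow 2 t).const_add s).hasDerivWithinAt) hinj,
    ← lintegral_const_mul' _ _ (by simp)]
  refine lintegral_congr fun t => ?_
  rw [add_sub_cancel_left, Real.sqrt_sq_eq_abs, ← mul_assoc, ← mul_assoc,
    ← ENNReal.ofReal_mul (abs_nonneg _), abs_mul, mul_assoc, abs_mul_abs_self, abs_two,
    ENNReal.ofReal_mul zero_le_two, ENNReal.ofReal_ofNat, pow_two]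

theorem image_add_sq_Ioi (s : ℝ) : (fun t : ℝ => s + t ^ 2) '' Set.Ioi 0 = Set.Ioi s := by
  ext ν
  constructor
  · rintro ⟨t, ht, rfl⟩
    have : 0 < t := ht
    have := pow_pos this 2
    simp only [Set.mem_Ioi]
    linarith
  · intro h
    have h' : 0 < ν - s := sub_pos.2 h
    exact ⟨√(ν - s), Real.sqrt_pos.2 h', by simp [Real.sq_sqrt h'.le]⟩

theorem image_add_sq_Iio (s : ℝ) : (fun t : ℝ => s + t ^ 2) '' Set.Iio 0 = Set.Ioi s := by
  ext ν
  constructor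
  · rintro ⟨t, ht, rfl⟩
    have : t < 0 := ht
    have := sq_pos_of_neg this
    simp only [Set.mem_Ioi]
    linarith
  · intro h
    have h' : 0 < ν - s := sub_pos.2 h
    exact ⟨-√(ν - s), neg_neg_of_pos (Real.sqrt_pos.2 h'), by simp [Real.sq_sqrt h'.le]⟩

theorem lintegral_sqrt_eq_lintegral_sq (g : ℝ → ENNReal) (s : ℝ) :
    ∫⁻ ν in Set.Ioi s, ENNReal.ofReal √(ν - s) * g ν
      = ∫⁻ t : ℝ, ENNReal.ofReal (t ^ 2) * g (s + t ^ 2) := by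
  have h1 := lintegral_two_sqrt_eq g s (Set.Ioi 0) measurableSet_Ioi (by
    intro a ha b hb h
    exact (pow_left_inj₀ (le_of_lt ha) (le_of_lt hb) two_ne_zero).1 (add_left_cancel h))
    (image_add_sq_Ioi s)
  have h2 := lintegral_two_sqrt_eq g s (Set.Iio 0) measurableSet_Iio (by
    intro a ha b hb h
    have h' : (-a) ^ 2 = (-b) ^ 2 := by simpa using h
    exact neg_injective ((pow_left_inj₀ (neg_nonneg.2 (le_of_lt ha))
      (neg_nonneg.2 (le_of_lt hb)) two_ne_zero).1 h'))
    (image_add_sq_Iio s)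
  have h3 : ∫⁻ t : ℝ, ENNReal.ofReal (t ^ 2) * g (s + t ^ 2)
      = (∫⁻ t in Set.Iio 0, ENNReal.ofReal (t ^ 2) * g (s + t ^ 2))
        + ∫⁻ t in Set.Ioi 0, ENNReal.ofReal (t ^ 2) * g (s + t ^ 2) := by
    rw [← lintegral_add_compl _ (measurableSet_Iio (a := (0 : ℝ))), Set.compl_Iio,
      restrict_Ioi_eq_restrict_Ici]
  -- Each half-line gives the left side as twice its own integral, so adding the halves gives the
  -- claim multiplied by 2.
  refine (ENNReal.mul_right_inj two_ne_zero ENNReal.ofNat_ne_top).1 ?_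
  rw [h3, mul_add, ← h1, ← h2, two_mul]

/-- Swapping integrals turns the left side into `½ ∫ f(ν) |{t : s + t² < ν}| dν`; that set is an
interval of length `2√(ν - s)`, and the substitution `ν = s + t²` yields the right side. Working in
`[0, ∞]` avoids boundary terms and integrability conditions. -/
theorem lintegral_FStar_add_sq {f : ℝ → ℝ} (hf : Measurable f) (s : ℝ) :
    ∫⁻ t : ℝ, FStar f (s + t ^ 2)
      = ∫⁻ t : ℝ, ENNReal.ofReal (t ^ 2) * ENNReal.ofReal (f (s + t ^ 2)) := by
  have hg : Measurable fun ν => ENNReal.ofReal (f ν) := hf.ennreal_ofReal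
  have hset : MeasurableSet {x : ℝ × ℝ | s + x.1 ^ 2 < x.2} :=
    measurableSet_lt (by fun_prop) (by fun_prop)
  have hFS : ∀ t : ℝ, FStar f (s + t ^ 2) = ∫⁻ ν, (1 / 2) *
      ({x : ℝ × ℝ | s + x.1 ^ 2 < x.2}.indicator (fun x => ENNReal.ofReal (f x.2)) (t, ν)) := by
    intro t
    rw [FStar, ← lintegral_indicator measurableSet_Ioi, ← lintegral_const_mul' _ _ (by simp)]
    rfl
  simp_rw [hFS]
  rw [lintegral_lintegral_swap (((hg.comp measurable_snd).indicator hset).const_mul _).aemeasurable,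
    ← lintegral_sqrt_eq_lintegral_sq (fun ν => ENNReal.ofReal (f ν)) s,
    ← lintegral_indicator measurableSet_Ioi]
  refine lintegral_congr fun ν => ?_
  have hrw : ∀ t : ℝ, (1 / 2 : ENNReal) *
      ({x : ℝ × ℝ | s + x.1 ^ 2 < x.2}.indicator (fun x => ENNReal.ofReal (f x.2)) (t, ν))
      = (Set.Ioo (-√(ν - s)) √(ν - s)).indicator
          (fun _ => (1 / 2) * ENNReal.ofReal (f ν)) t := by
    intro t
    have hiff : s + t ^ 2 < ν ↔ t ∈ Set.Ioo (-√(ν - s)) √(ν - s) := by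
      rw [Set.mem_Ioo, ← Real.sq_lt, lt_sub_iff_add_lt']
    by_cases h : s + t ^ 2 < ν
    · rw [Set.indicator_of_mem (show (t, ν) ∈ {x : ℝ × ℝ | s + x.1 ^ 2 < x.2} from h),
        Set.indicator_of_mem (hiff.1 h)]
    · rw [Set.indicator_of_notMem (show (t, ν) ∉ {x : ℝ × ℝ | s + x.1 ^ 2 < x.2} from h),
        Set.indicator_of_notMem (fun h' => h (hiff.2 h')), mul_zero]
  simp_rw [hrw]
  rw [lintegral_indicator_const measurableSet_Ioo, Real.volume_Ioo, sub_neg_eq_add, ← two_mul,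
    ENNReal.ofReal_mul zero_le_two, ENNReal.ofReal_ofNat]
  by_cases h : s < ν
  · rw [Set.indicator_of_mem (show ν ∈ Set.Ioi s from h)]
    calc _ = (1 / 2 * 2) * (ENNReal.ofReal √(ν - s) * ENNReal.ofReal (f ν)) := by ring
      _ = _ := by
        rw [one_div, ENNReal.inv_mul_cancel two_ne_zero ENNReal.ofNat_ne_top, one_mul]
  -- For `ν ≤ s` the real square root takes the value 0, in agreement with the empty interval.
  · rw [Set.indicator_of_notMem (show ν ∉ Set.Ioi s from h),
      Real.sqrt_eq_zero_of_nonpos (by linarith)]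
    simp

theorem measurable_FStar {f : ℝ → ℝ} (hf : Measurable f) : Measurable (FStar f) := by
  have hset : MeasurableSet {x : ℝ × ℝ | x.1 < x.2} := measurableSet_lt measurable_fst measurable_snd
  have h := ((hf.ennreal_ofReal.comp measurable_snd).indicator hset).lintegral_prod_right'
    (ν := (volume : Measure ℝ))
  have hFS : FStar f = fun t => (1 / 2) * ∫⁻ ν,
      ({x : ℝ × ℝ | x.1 < x.2}.indicator (fun x => ENNReal.ofReal (f x.2)) (t, ν)) := by
    funext t
    rw [FStar, ← lintegral_indicator measurableSet_Ioi]
    rfl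
  rw [hFS]
  exact h.const_mul _

end IntegrationByParts

/-! ### Integration by parts in a single matrix entry -/

section Coordinates

theorem lintegral_pi_eq_of_update {ι E : Type*} [Fintype ι] [DecidableEq ι] [MeasureSpace E]
    [SigmaFinite (volume : Measure E)] (i : ι) {G H : (ι → E) → ENNReal}
    (hG : Measurable G) (hH : Measurable H)
    (h : ∀ y, ∫⁻ t, G (Function.update y i t) = ∫⁻ t, H (Function.update y i t)) :
    ∫⁻ y, G y = ∫⁻ y, H y := by
  refine lintegral_eq_of_lmarginal_eq (μ := fun _ : ι => (volume : Measure E)) {i} hG hH ?_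
  rw [lmarginal_singleton, lmarginal_singleton]
  exact funext h

/-- The squared Frobenius norm of the pair `(z, u)`. -/
noncomputable def sumSq {q m p : ℕ} (x : Obs q m p) : ℝ :=
  (∑ i, ∑ j, x.1 i j ^ 2) + ∑ i, ∑ j, x.2 i j ^ 2

theorem continuous_sumSq {q m p : ℕ} : Continuous (sumSq : Obs q m p → ℝ) := by
  unfold sumSq
  fun_prop

/-- With all other entries frozen, the squared norm has the form `s + t²` required by
`lintegral_FStar_add_sq`. -/
theorem sum_sum_update_update_sq {m p : ℕ} (y : Fin m → Fin p → ℝ) (i : Fin m) (j : Fin p)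
    (c : ℝ) :
    ∃ s : ℝ, ∀ t : ℝ,
      c + ∑ k, ∑ l, Function.update y i (Function.update (y i) j t) k l ^ 2 = s + t ^ 2 := by
  refine ⟨c + ((∑ l ∈ {j}ᶜ, y i l ^ 2) + ∑ k ∈ {i}ᶜ, ∑ l, y k l ^ 2), fun t => ?_⟩
  rw [Fintype.sum_eq_add_sum_compl i, Fintype.sum_eq_add_sum_compl j, Function.update_self,
    Function.update_self]
  have h1 : ∑ l ∈ {j}ᶜ, Function.update (y i) j t l ^ 2 = ∑ l ∈ {j}ᶜ, y i l ^ 2 := by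
    refine Finset.sum_congr rfl fun l hl => ?_
    rw [Function.update_of_ne (by simpa using hl)]
  have h2 : ∑ k ∈ {i}ᶜ, ∑ l, Function.update y i (Function.update (y i) j t) k l ^ 2
      = ∑ k ∈ {i}ᶜ, ∑ l, y k l ^ 2 := by
    refine Finset.sum_congr rfl fun k hk => ?_
    rw [Function.update_of_ne (by simpa using hk)]
  rw [h1, h2]
  ring

theorem lintegral_sq_mul_eq_lintegral_FStar {q m p : ℕ} {f : ℝ → ℝ} (hf : Measurable f)
    (i : Fin m) (j : Fin p) :
    ∫⁻ x : Obs q m p, ENNReal.ofReal (x.2 i j ^ 2) * ENNReal.ofReal (f (sumSq x))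
      = ∫⁻ x : Obs q m p, FStar f (sumSq x) := by
  have hm1 : Measurable fun x : Obs q m p =>
      ENNReal.ofReal (x.2 i j ^ 2) * ENNReal.ofReal (f (sumSq x)) := by
    have h1 : Measurable fun x : Obs q m p => x.2 i j ^ 2 := by fun_prop
    exact h1.ennreal_ofReal.mul (hf.comp continuous_sumSq.measurable).ennreal_ofReal
  have hm2 : Measurable fun x : Obs q m p => FStar f (sumSq x) :=
    (measurable_FStar hf).comp continuous_sumSq.measurable
  rw [Measure.volume_eq_prod, lintegral_prod _ hm1.aemeasurable, lintegral_prod _ hm2.aemeasurable]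
  refine lintegral_congr fun z => ?_
  -- Compare the integrals over row `i` alone, then over entry `j` of that row.
  refine lintegral_pi_eq_of_update i (hm1.comp measurable_prodMk_left)
    (hm2.comp measurable_prodMk_left) fun y => ?_
  have hu : Measurable fun w : Fin p → ℝ => Function.update y i w := measurable_update y
  refine lintegral_pi_eq_of_update j (hm1.comp (measurable_prodMk_left.comp hu))
    (hm2.comp (measurable_prodMk_left.comp hu)) fun w => ?_
  obtain ⟨s, hs⟩ := sum_sum_update_update_sq (Function.update y i w) i j
    (∑ k, ∑ l, z k l ^ 2)
  simp only [Function.update_self, Function.update_idem] at hs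
  simp only [sumSq, Function.update_self, hs]
  exact (lintegral_FStar_add_sq hf s).symm

end Coordinates

/-! ### Almost every matrix has full rank -/

section FullRank

/-- Induction on `k`: once the first `k < p` rows are independent, the next row breaks independence
only by lying in their span, a proper subspace and hence a null set. -/
theorem ae_linearIndependent_castLE {m p k : ℕ} (hkm : k ≤ m) (hkp : k ≤ p) :
    ∀ᵐ u : Fin m → Fin p → ℝ, LinearIndependent ℝ fun i : Fin k => u (Fin.castLE hkm i) := by
  induction k with
  | zero => exact Filter.Eventually.of_forall fun u => linearIndependent_empty_type
  | succ k ih =>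
    have hmeas : ∀ (l : ℕ) (hl : l ≤ m), MeasurableSet {u : Fin m → Fin p → ℝ |
        LinearIndependent ℝ fun i : Fin l => u (Fin.castLE hl i)} := by
      intro l hl
      have hc : Continuous fun (u : Fin m → Fin p → ℝ) (i : Fin l) => u (Fin.castLE hl i) := by
        fun_prop
      exact (isOpen_setOfPred_linearIndependent.preimage hc).measurableSet
    have hk := ih (by omega) (by omega)
    set P : Set (Fin m → Fin p → ℝ) :=
      {u | LinearIndependent ℝ fun i : Fin k => u (Fin.castLE (by omega) i)} with hP
    set Q : Set (Fin m → Fin p → ℝ) :=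
      {u | LinearIndependent ℝ fun i : Fin (k + 1) => u (Fin.castLE hkm i)} with hQ
    have hB : MeasurableSet (P \ Q) := (hmeas _ _).diff (hmeas _ _)
    -- The exceptional set is null because its section in row `k`, the other rows being fixed, is
    -- null.
    have hnull : volume (P \ Q) = 0 := by
      rw [← lintegral_indicator_one hB, ← lintegral_zero]
      refine lintegral_pi_eq_of_update (⟨k, by omega⟩ : Fin m) (measurable_one.indicator hB)
        measurable_const fun y => ?_
      rw [lintegral_zero]
      have hne : Submodule.span ℝ (Set.range fun i : Fin k => y (Fin.castLE (by omega) i)) ≠ ⊤ := by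
        intro h
        have h1 := finrank_range_le_card (R := ℝ) (fun i : Fin k => y (Fin.castLE (by omega) i))
        rw [Set.finrank, h, finrank_top] at h1
        simp at h1
        omega
      have h0 := Measure.addHaar_submodule (volume : Measure (Fin p → ℝ)) _ hne
      refine (lintegral_eq_zero_iff' ?_).2 ?_
      · exact ((measurable_one.indicator hB).comp (measurable_update y)).aemeasurable
      · filter_upwards [measure_eq_zero_iff_ae_notMem.1 h0] with w hw
        refine Set.indicator_of_notMem ?_ _
        rintro ⟨h1, h2⟩
        refine h2 ?_
        have hlast : ∀ i : Fin k, Function.update y (⟨k, by omega⟩ : Fin m) w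
            (Fin.castLE (by omega) i) = y (Fin.castLE (by omega) i) := by
          intro i
          refine Function.update_of_ne ?_ _ _
          intro h
          have := congrArg Fin.val h
          simp at this
          omega
        have h3 := h1
        simp only [hP, Set.mem_ofPred_eq, hlast] at h3
        have h4 := h3.finSnoc hw
        simp only [hQ, Set.mem_ofPred_eq]
        have h5 : (fun i : Fin (k + 1) => Function.update y (⟨k, by omega⟩ : Fin m) w
            (Fin.castLE hkm i))
            = Fin.snoc (fun i : Fin k => y (Fin.castLE (by omega) i)) w := by
          funext i
          refine Fin.lastCases ?_ (fun i => ?_) i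
          · rw [Fin.snoc_last]
            exact Function.update_self _ _ _
          · rw [Fin.snoc_castSucc]
            exact hlast i
        rw [h5]
        exact h4
    filter_upwards [hk, measure_eq_zero_iff_ae_notMem.1 hnull] with u h1 h2
    by_contra h3
    exact h2 ⟨h1, h3⟩

theorem ae_rank_eq_min (m p : ℕ) :
    ∀ᵐ u : Fin m → Fin p → ℝ, (Matrix.of u).rank = min p m := by
  filter_upwards [ae_linearIndependent_castLE (min_le_right p m) (min_le_left p m)] with u hu
  refine le_antisymm (le_min ((Matrix.rank_le_width _)) ((Matrix.rank_le_height _))) ?_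
  have h1 : ((Matrix.of u).submatrix (Fin.castLE (min_le_right p m)) id).rank = min p m := by
    rw [LinearIndependent.rank_matrix (R := ℝ) (by exact hu), Fintype.card_fin]
  rw [← h1]
  exact Matrix.rank_submatrix_le _ _ _

end FullRank

/-! ### Reduction to `θ = 0`, `Σ = I` -/

section ChangeOfVariables

variable {q m p : ℕ}

theorem exists_transpose_mul_self_of_posDef {Sig : Matrix (Fin p) (Fin p) ℝ} (h : Sig.PosDef) :
    ∃ A : Matrix (Fin p) (Fin p) ℝ, A.det ≠ 0 ∧ Sig = A.transpose * A := by
  open scoped MatrixOrder in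
  obtain ⟨A, hA⟩ := CStarAlgebra.nonneg_iff_eq_star_mul_self.mp h.posSemidef.nonneg
  rw [Matrix.star_eq_conjTranspose, Matrix.conjTranspose_eq_transpose_of_trivial] at hA
  refine ⟨A, fun h0 => ?_, hA⟩
  have hd := h.det_pos
  rw [hA, Matrix.det_mul, h0, mul_zero] at hd
  exact hd.false

/-- The linear map `(z, u) ↦ (z A, u A)`. -/
noncomputable def mulRightObs (A : Matrix (Fin p) (Fin p) ℝ) : Obs q m p →ₗ[ℝ] Obs q m p :=
  LinearMap.prodMap
    (LinearMap.pi fun i => (Matrix.toLin' A.transpose).comp (LinearMap.proj i))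
    (LinearMap.pi fun i => (Matrix.toLin' A.transpose).comp (LinearMap.proj i))

theorem det_mulRightObs (A : Matrix (Fin p) (Fin p) ℝ) :
    LinearMap.det (mulRightObs A : Obs q m p →ₗ[ℝ] Obs q m p) = A.det ^ (q + m) := by
  rw [mulRightObs, LinearMap.det_prodMap, LinearMap.det_pi, LinearMap.det_pi, LinearMap.det_toLin',
    Matrix.det_transpose, Finset.prod_const, Finset.prod_const, Finset.card_univ, Finset.card_univ,
    Fintype.card_fin, Fintype.card_fin, pow_add]

theorem zMat_mulRightObs_add (A : Matrix (Fin p) (Fin p) ℝ) (θ : Matrix (Fin q) (Fin p) ℝ)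
    (y : Obs q m p) :
    zMat (mulRightObs A y + ((fun i j => θ i j, 0) : Obs q m p)) - θ = zMat y * A := by
  ext i j
  simp [zMat, mulRightObs, Matrix.mul_apply, Matrix.mulVec, dotProduct, mul_comm]

theorem uMat_mulRightObs_add (A : Matrix (Fin p) (Fin p) ℝ) (θ : Matrix (Fin q) (Fin p) ℝ)
    (y : Obs q m p) :
    uMat (mulRightObs A y + ((fun i j => θ i j, 0) : Obs q m p)) = uMat y * A := by
  ext i j
  simp [uMat, mulRightObs, Matrix.mul_apply, Matrix.mulVec, dotProduct, mul_comm]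

theorem mul_mul_inv_mul_transpose {k : ℕ} {A : Matrix (Fin p) (Fin p) ℝ} (hA : A.det ≠ 0)
    (Z : Matrix (Fin k) (Fin p) ℝ) :
    (Z * A) * (A.transpose * A)⁻¹ * (Z * A).transpose = Z * Z.transpose := by
  have h1 : IsUnit A.det := isUnit_iff_ne_zero.2 hA
  have h2 : IsUnit A.transpose.det := by rwa [Matrix.det_transpose]
  rw [Matrix.mul_inv_rev, Matrix.transpose_mul]
  calc Z * A * (A⁻¹ * A.transpose⁻¹) * (A.transpose * Z.transpose)
      = Z * (A * A⁻¹) * (A.transpose⁻¹ * A.transpose) * Z.transpose := by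
        simp only [Matrix.mul_assoc]
    _ = _ := by rw [Matrix.mul_nonsing_inv _ h1, Matrix.nonsing_inv_mul _ h2, Matrix.mul_one,
        Matrix.mul_one]

theorem trace_mul_transpose_eq_sum_sq {k : ℕ} (Z : Matrix (Fin k) (Fin p) ℝ) :
    Matrix.trace (Z * Z.transpose) = ∑ i, ∑ j, Z i j ^ 2 := by
  simp [Matrix.trace, Matrix.mul_apply, pow_two]

theorem trace_inv_mul_sampleCov (Sig : Matrix (Fin p) (Fin p) ℝ) (x : Obs q m p) :
    Matrix.trace (Sig⁻¹ * sampleCov x) = Matrix.trace (uMat x * Sig⁻¹ * (uMat x).transpose) := by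
  rw [sampleCov, ← Matrix.mul_assoc, Matrix.trace_mul_comm, ← Matrix.mul_assoc]

theorem quadForm_mulRightObs_add {A : Matrix (Fin p) (Fin p) ℝ} (hA : A.det ≠ 0)
    (θ : Matrix (Fin q) (Fin p) ℝ) (y : Obs q m p) :
    quadForm θ (A.transpose * A) (mulRightObs A y + ((fun i j => θ i j, 0) : Obs q m p))
      = sumSq y := by
  rw [quadForm, zMat_mulRightObs_add, uMat_mulRightObs_add, mul_mul_inv_mul_transpose hA,
    mul_mul_inv_mul_transpose hA, trace_mul_transpose_eq_sum_sq, trace_mul_transpose_eq_sum_sq]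
  rfl

theorem trace_inv_mul_sampleCov_mulRightObs_add {A : Matrix (Fin p) (Fin p) ℝ} (hA : A.det ≠ 0)
    (θ : Matrix (Fin q) (Fin p) ℝ) (y : Obs q m p) :
    Matrix.trace ((A.transpose * A)⁻¹ *
      sampleCov (mulRightObs A y + ((fun i j => θ i j, 0) : Obs q m p)))
      = ∑ i, ∑ j, y.2 i j ^ 2 := by
  rw [trace_inv_mul_sampleCov, uMat_mulRightObs_add, mul_mul_inv_mul_transpose hA,
    trace_mul_transpose_eq_sum_sq]
  rfl

theorem detFactor_nonneg {Sig : Matrix (Fin p) (Fin p) ℝ} (h : Sig.PosDef) :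
    0 ≤ detFactor q m Sig :=
  Real.rpow_nonneg h.det_pos.le _

/-- `det Σ = |det A|²`, so `|Σ|^{-n/2}` is exactly the inverse Jacobian of `(z, u) ↦ (zA, uA)`. -/
theorem detFactor_transpose_mul_self (A : Matrix (Fin p) (Fin p) ℝ) :
    detFactor q m (A.transpose * A) = |(A.det ^ (q + m))⁻¹| := by
  rw [detFactor, Matrix.det_mul, Matrix.det_transpose, ← abs_mul_abs_self, ← pow_two,
    ← Real.rpow_natCast |A.det| 2, ← Real.rpow_mul (abs_nonneg _), abs_inv, abs_pow,
    ← Real.rpow_natCast, ← Real.rpow_neg (abs_nonneg _)]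
  congr 1
  push_cast
  ring

theorem lintegral_detFactor_mul {A : Matrix (Fin p) (Fin p) ℝ} (hA : A.det ≠ 0)
    (θ : Matrix (Fin q) (Fin p) ℝ) {G : Obs q m p → ENNReal} (hG : Measurable G) :
    ∫⁻ x, ENNReal.ofReal (detFactor q m (A.transpose * A)) * G x
      = ∫⁻ y, G (mulRightObs A y + ((fun i j => θ i j, 0) : Obs q m p)) := by
  have hhaar : (volume : Measure (Obs q m p)).IsAddHaarMeasure := by
    have h0 : (volume : Measure (Fin p → ℝ)).IsAddHaarMeasure := inferInstance
    have h1 (k : ℕ) : (volume : Measure (Fin k → Fin p → ℝ)).IsAddHaarMeasure := inferInstance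
    rw [Measure.volume_eq_prod]
    infer_instance
  have hdet : LinearMap.det (mulRightObs A : Obs q m p →ₗ[ℝ] Obs q m p) ≠ 0 := by
    rw [det_mulRightObs]
    exact pow_ne_zero _ hA
  have hT : Measurable (mulRightObs A : Obs q m p →ₗ[ℝ] Obs q m p) :=
    (LinearMap.continuous_of_finiteDimensional _).measurable
  have hmap := Measure.map_linearMap_addHaar_eq_smul_addHaar
    (volume : Measure (Obs q m p)) hdet
  have hG' : Measurable fun x : Obs q m p => G (x + ((fun i j => θ i j, 0) : Obs q m p)) :=
    hG.comp (measurable_add_const _)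
  rw [← lintegral_map hG' hT, hmap, lintegral_smul_measure, lintegral_add_right_eq_self G,
    detFactor_transpose_mul_self, det_mulRightObs, lintegral_const_mul _ hG, smul_eq_mul]

theorem continuous_quadForm (θ : Matrix (Fin q) (Fin p) ℝ) (Sig : Matrix (Fin p) (Fin p) ℝ) :
    Continuous (quadForm θ Sig : Obs q m p → ℝ) := by
  have h1 : Continuous (zMat : Obs q m p → _) := continuous_fst
  have h2 : Continuous (uMat : Obs q m p → _) := continuous_snd
  unfold quadForm
  fun_prop

theorem continuous_trace_inv_mul_sampleCov (Sig : Matrix (Fin p) (Fin p) ℝ) :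
    Continuous fun x : Obs q m p => Matrix.trace (Sig⁻¹ * sampleCov x) := by
  have h2 : Continuous (uMat : Obs q m p → _) := continuous_snd
  unfold sampleCov
  fun_prop

theorem KStar_eq_lintegral_FStar_sumSq {f : ℝ → ℝ} (hf : Measurable f)
    (θ : Matrix (Fin q) (Fin p) ℝ) {Sig : Matrix (Fin p) (Fin p) ℝ} (hSig : Sig.PosDef) :
    KStar m f θ Sig = ∫⁻ x : Obs q m p, FStar f (sumSq x) := by
  obtain ⟨A, hA, rfl⟩ := exists_transpose_mul_self_of_posDef hSig
  have hG : Measurable fun x : Obs q m p => FStar f (quadForm θ (A.transpose * A) x) :=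
    (measurable_FStar hf).comp (continuous_quadForm θ _).measurable
  rw [KStar, lintegral_detFactor_mul hA θ hG]
  simp only [quadForm_mulRightObs_add hA]

theorem trace_inv_mul_sampleCov_nonneg {Sig : Matrix (Fin p) (Fin p) ℝ} (hSig : Sig.PosDef)
    (x : Obs q m p) : 0 ≤ Matrix.trace (Sig⁻¹ * sampleCov x) := by
  rw [trace_inv_mul_sampleCov]
  have h := hSig.inv.posSemidef.mul_mul_conjTranspose_same (uMat x)
  rw [Matrix.conjTranspose_eq_transpose_of_trivial] at h
  exact h.trace_nonneg

/-- The trace is the squared Frobenius norm of `u A⁻¹`, where `Σ = AᵀA`. -/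
theorem uMat_eq_zero_of_trace_eq_zero {Sig : Matrix (Fin p) (Fin p) ℝ} (hSig : Sig.PosDef)
    {x : Obs q m p} (hx : Matrix.trace (Sig⁻¹ * sampleCov x) = 0) : uMat x = 0 := by
  obtain ⟨A, hA, rfl⟩ := exists_transpose_mul_self_of_posDef hSig
  have hu : IsUnit A.det := isUnit_iff_ne_zero.2 hA
  have h := mul_mul_inv_mul_transpose hA (uMat x * A⁻¹)
  rw [Matrix.mul_assoc (uMat x), Matrix.nonsing_inv_mul _ hu, Matrix.mul_one] at h
  rw [trace_inv_mul_sampleCov, h, ← Matrix.conjTranspose_eq_transpose_of_trivial,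
    Matrix.trace_mul_conjTranspose_self_eq_zero_iff] at hx
  rw [← Matrix.mul_one (uMat x), ← Matrix.nonsing_inv_mul _ hu, ← Matrix.mul_assoc, hx,
    Matrix.zero_mul]

/-- The Stein-Haff identity for the scale matrix itself. -/
theorem lintegral_law_trace_inv_mul_sampleCov {f : ℝ → ℝ} (hf : Measurable f)
    (θ : Matrix (Fin q) (Fin p) ℝ) {Sig : Matrix (Fin p) (Fin p) ℝ} (hSig : Sig.PosDef) :
    ∫⁻ x : Obs q m p, ENNReal.ofReal (Matrix.trace (Sig⁻¹ * sampleCov x)) ∂(law f θ Sig)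
      = (m * p : ℕ) * KStar m f θ Sig := by
  have hd : 0 ≤ detFactor q m Sig := detFactor_nonneg hSig
  rw [KStar_eq_lintegral_FStar_sumSq hf θ hSig]
  obtain ⟨A, hA, rfl⟩ := exists_transpose_mul_self_of_posDef hSig
  have hfq : Measurable fun x : Obs q m p => f (quadForm θ (A.transpose * A) x) :=
    hf.comp (continuous_quadForm θ _).measurable
  have htr := (continuous_trace_inv_mul_sampleCov (q := q) (m := m)
    (A.transpose * A)).measurable.ennreal_ofReal
  rw [law, lintegral_withDensity_eq_lintegral_mul _ (hfq.const_mul _).ennreal_ofReal htr]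
  simp only [Pi.mul_apply, ENNReal.ofReal_mul hd, mul_assoc]
  rw [lintegral_detFactor_mul hA θ (G := fun x => ENNReal.ofReal (f (quadForm θ _ x)) *
    ENNReal.ofReal (Matrix.trace (_ * sampleCov x))) (hfq.ennreal_ofReal.mul htr)]
  simp only [quadForm_mulRightObs_add hA, trace_inv_mul_sampleCov_mulRightObs_add hA]
  have hsum : ∀ y : Obs q m p, ENNReal.ofReal (f (sumSq y)) * ENNReal.ofReal (∑ i, ∑ j, y.2 i j ^ 2)
      = ∑ i, ∑ j, ENNReal.ofReal (y.2 i j ^ 2) * ENNReal.ofReal (f (sumSq y)) := by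
    intro y
    rw [ENNReal.ofReal_sum_of_nonneg fun i _ => Finset.sum_nonneg fun j _ => sq_nonneg _,
      Finset.mul_sum]
    refine Finset.sum_congr rfl fun i _ => ?_
    rw [ENNReal.ofReal_sum_of_nonneg fun j _ => sq_nonneg _, Finset.mul_sum]
    exact Finset.sum_congr rfl fun j _ => mul_comm _ _
  have hmeas : ∀ (i : Fin m) (j : Fin p), Measurable fun y : Obs q m p =>
      ENNReal.ofReal (y.2 i j ^ 2) * ENNReal.ofReal (f (sumSq y)) := by
    intro i j
    have h1 : Measurable fun x : Obs q m p => x.2 i j ^ 2 := by fun_prop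
    exact h1.ennreal_ofReal.mul (hf.comp continuous_sumSq.measurable).ennreal_ofReal
  simp only [hsum]
  rw [lintegral_finsetSum _ fun i _ => Finset.measurable_fun_sum _ fun j _ => hmeas i j]
  simp only [lintegral_finsetSum _ fun j _ => hmeas _ j, lintegral_sq_mul_eq_lintegral_FStar hf,
    Finset.sum_const, Finset.card_univ, Fintype.card_fin, nsmul_eq_mul]
  push_cast
  ring

end ChangeOfVariables

/-! ### Algebra of the data-based loss -/

section Loss

variable {p : ℕ}

/-- The trace of a projection is its rank, and `S = S * (S⁺ * S)` shows that `S⁺S` has the rank of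
`S`. -/
theorem trace_pinv_mul_self (S : Matrix (Fin p) (Fin p) ℝ) :
    Matrix.trace (pinv S * S) = S.rank := by
  have hS := isMoorePenrose_pinv S
  have hid : IsIdempotentElem (Matrix.toLin' (pinv S * S)) := by
    rw [IsIdempotentElem, Module.End.mul_eq_comp, ← Matrix.toLin'_mul, ← Matrix.mul_assoc,
      hS.mul_mul_right]
  have hrank : (pinv S * S).rank = S.rank := by
    refine le_antisymm (Matrix.rank_mul_le_right _ _) ?_
    conv_lhs => rw [← hS.mul_mul_left, Matrix.mul_assoc]
    exact Matrix.rank_mul_le_right _ _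
  rw [← Matrix.trace_toLin'_eq, (LinearMap.IsIdempotentElem.isProj_range _ hid).trace, ← hrank]
  rfl

theorem loss_smul_self (S : Matrix (Fin p) (Fin p) ℝ) {Sig : Matrix (Fin p) (Fin p) ℝ}
    (hSig : Sig.PosDef) (a : ℝ) :
    loss S (a • S) Sig = a ^ 2 * Matrix.trace (Sig⁻¹ * S) - 2 * a * S.rank
      + Matrix.trace (pinv S * Sig) := by
  have hu : IsUnit Sig.det := isUnit_iff_ne_zero.2 hSig.det_pos.ne'
  have hS := isMoorePenrose_pinv S
  have hexp : pinv S * Sig * (Sig⁻¹ * (a • S) - 1) ^ 2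
      = a ^ 2 • (pinv S * S * Sig⁻¹ * S) - (2 * a) • (pinv S * S) + pinv S * Sig := by
    have h1 : pinv S * Sig * (Sig⁻¹ * S) = pinv S * S := by
      rw [Matrix.mul_assoc, ← Matrix.mul_assoc Sig, Matrix.mul_nonsing_inv _ hu, Matrix.one_mul]
    have h2 : pinv S * Sig * (Sig⁻¹ * S * (Sig⁻¹ * S)) = pinv S * S * Sig⁻¹ * S := by
      rw [← Matrix.mul_assoc, h1, ← Matrix.mul_assoc]
    have h3 : (Sig⁻¹ * (a • S) - 1) ^ 2
        = a ^ 2 • (Sig⁻¹ * S * (Sig⁻¹ * S)) - (2 * a) • (Sig⁻¹ * S) + 1 := by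
      rw [Matrix.mul_smul, pow_two, sub_mul, mul_sub, mul_one, one_mul, smul_mul_smul_comm,
        two_mul, add_smul, pow_two]
      abel
    rw [h3, Matrix.mul_add, Matrix.mul_sub, Matrix.mul_smul, Matrix.mul_smul, h1, h2,
      Matrix.mul_one]
  have htr : Matrix.trace (pinv S * S * Sig⁻¹ * S) = Matrix.trace (Sig⁻¹ * S) := by
    rw [Matrix.mul_assoc, Matrix.trace_mul_comm, Matrix.mul_assoc, ← Matrix.mul_assoc S,
      hS.mul_mul_left]
  rw [loss, hexp, Matrix.trace_add, Matrix.trace_sub, Matrix.trace_smul, Matrix.trace_smul, htr,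
    trace_pinv_mul_self, smul_eq_mul, smul_eq_mul]

end Loss

/-! ### Almost sure rank, expectation and positivity of `K*` -/

section Law

variable {q m p : ℕ}

theorem ae_law_rank_sampleCov (f : ℝ → ℝ) (θ : Matrix (Fin q) (Fin p) ℝ)
    (Sig : Matrix (Fin p) (Fin p) ℝ) :
    ∀ᵐ x : Obs q m p ∂(law f θ Sig), (sampleCov x).rank = min p m := by
  have h : ∀ᵐ x : Obs q m p, (uMat x).rank = min p m :=
    (Measure.quasiMeasurePreserving_snd (μ := (volume : Measure (Fin q → Fin p → ℝ)))
      (ν := (volume : Measure (Fin m → Fin p → ℝ)))).ae (ae_rank_eq_min m p)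
  -- The law has a density, so Lebesgue-null sets are null for it.
  filter_upwards [(withDensity_absolutelyContinuous volume _).ae_le h] with x hx
  rw [sampleCov, Matrix.rank_transpose_mul_self, hx]

theorem integral_law_trace_inv_mul_sampleCov {f : ℝ → ℝ} (hf : Measurable f)
    (θ : Matrix (Fin q) (Fin p) ℝ) {Sig : Matrix (Fin p) (Fin p) ℝ} (hSig : Sig.PosDef) :
    ∫ x : Obs q m p, Matrix.trace (Sig⁻¹ * sampleCov x) ∂(law f θ Sig)
      = (m * p : ℕ) * (KStar m f θ Sig).toReal := by
  rw [integral_eq_lintegral_of_nonneg_ae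
    (Filter.Eventually.of_forall (trace_inv_mul_sampleCov_nonneg hSig))
    (continuous_trace_inv_mul_sampleCov Sig).aestronglyMeasurable,
    lintegral_law_trace_inv_mul_sampleCov hf θ hSig, ENNReal.toReal_mul, ENNReal.toReal_natCast]

/-- If `K*` vanished, `tr(Σ⁻¹S)` would have mean 0, forcing `U = 0` almost surely, against `rank S =
min p m > 0`. -/
theorem KStar_ne_zero (hm : 0 < m) (hp : 0 < p) {f : ℝ → ℝ} (hf : Measurable f)
    (θ : Matrix (Fin q) (Fin p) ℝ) {Sig : Matrix (Fin p) (Fin p) ℝ} (hSig : Sig.PosDef)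
    [IsProbabilityMeasure (law f θ Sig : Measure (Obs q m p))] : KStar m f θ Sig ≠ 0 := by
  intro h0
  have h := lintegral_law_trace_inv_mul_sampleCov (m := m) hf θ hSig
  rw [h0, mul_zero, lintegral_eq_zero_iff
    (continuous_trace_inv_mul_sampleCov Sig).measurable.ennreal_ofReal] at h
  obtain ⟨x, hx, hr⟩ := (h.and (ae_law_rank_sampleCov f θ Sig)).exists
  have hu := uMat_eq_zero_of_trace_eq_zero hSig
    (le_antisymm (ENNReal.ofReal_eq_zero.1 hx) (trace_inv_mul_sampleCov_nonneg hSig x))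
  rw [sampleCov, hu, Matrix.mul_zero, Matrix.rank_zero] at hr
  omega

theorem loss_smul_sampleCov_ae_eq (f : ℝ → ℝ) (θ : Matrix (Fin q) (Fin p) ℝ)
    {Sig : Matrix (Fin p) (Fin p) ℝ} (hSig : Sig.PosDef) (a : ℝ) :
    (fun x : Obs q m p => loss (sampleCov x) (a • sampleCov x) Sig) =ᵐ[law f θ Sig]
      fun x => a ^ 2 * Matrix.trace (Sig⁻¹ * sampleCov x) - 2 * a * (min p m : ℕ)
        + Matrix.trace (pinv (sampleCov x) * Sig) := by
  filter_upwards [ae_law_rank_sampleCov f θ Sig] with x hx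
  rw [loss_smul_self _ hSig, hx]

end Law

end EllipticalScale

/-! ### The risk of `aS` and its minimizer -/

theorem mainTheorem3 (q m p : ℕ) (hm : 0 < m) (hp : 0 < p)
    (f : ℝ → ℝ) (hf : Measurable f) (hf0 : ∀ t, 0 ≤ t → 0 ≤ f t)
    (θ : Matrix (Fin q) (Fin p) ℝ) (Sig : Matrix (Fin p) (Fin p) ℝ) (hSig : Sig.PosDef)
    (hprob : IsProbabilityMeasure
      (EllipticalScale.law f θ Sig : Measure (EllipticalScale.Obs q m p)))
    (hK : EllipticalScale.KStar m f θ Sig < ⊤)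
    (hS : Integrable
      (fun x : EllipticalScale.Obs q m p =>
        Matrix.trace (Sig⁻¹ * EllipticalScale.sampleCov x))
      (EllipticalScale.law f θ Sig))
    (hSp : Integrable
      (fun x : EllipticalScale.Obs q m p =>
        Matrix.trace (Sig * EllipticalScale.pinv (EllipticalScale.sampleCov x)))
      (EllipticalScale.law f θ Sig))
    (K : ℝ) (hKdef : K = (EllipticalScale.KStar m f θ Sig).toReal)
    (r v : ℕ) (hr : r = min p m) (hv : v = max p m)
    (R : ℝ → ℝ)
    (hR : ∀ a, R a = EllipticalScale.risk f θ Sig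
      (fun x : EllipticalScale.Obs q m p => a • EllipticalScale.sampleCov x))
    (a₀ : ℝ) (ha₀ : a₀ = 1 / (K * v)) :
    -- the normalizing constant does not depend on the unknown parameters
    (∀ (θ' : Matrix (Fin q) (Fin p) ℝ) (Sig' : Matrix (Fin p) (Fin p) ℝ), Sig'.PosDef →
      EllipticalScale.KStar m f θ' Sig' = EllipticalScale.KStar m f θ Sig) ∧
    -- the risk of `a S` is finite and has the announced value
    (∀ a : ℝ, 0 < a →
      Integrable
        (fun x : EllipticalScale.Obs q m p =>
          EllipticalScale.loss (EllipticalScale.sampleCov x)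
            (a • EllipticalScale.sampleCov x) Sig)
        (EllipticalScale.law f θ Sig) ∧
      R a = a ^ 2 * K * r * v - 2 * a * r
        + ∫ x : EllipticalScale.Obs q m p,
            Matrix.trace (EllipticalScale.pinv (EllipticalScale.sampleCov x) * Sig)
            ∂(EllipticalScale.law f θ Sig)) ∧
    -- `a₀` is the unique minimizer among positive constants
    0 < K ∧ 0 < a₀ ∧ IsMinOn R (Set.Ioi 0) a₀ ∧
    (∀ a : ℝ, 0 < a → a ≠ a₀ → R a₀ < R a) := by
  have hK0 : 0 < K := by
    rw [hKdef]
    exact ENNReal.toReal_pos (EllipticalScale.KStar_ne_zero hm hp hf θ hSig) hK.ne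
  have hSp' : Integrable (fun x : EllipticalScale.Obs q m p =>
      Matrix.trace (EllipticalScale.pinv (EllipticalScale.sampleCov x) * Sig))
      (EllipticalScale.law f θ Sig) := by
    simpa only [Matrix.trace_mul_comm Sig] using hSp
  -- This product treats singular and invertible `S` together.
  have hrv : m * p = r * v := by rw [hr, hv, min_mul_max, mul_comm]
  have hr0 : (0 : ℝ) < r := by rw [hr]; exact_mod_cast lt_min hp hm
  have hv0 : (0 : ℝ) < v := by rw [hv]; exact_mod_cast lt_max_of_lt_left hp
  have hmain : ∀ a : ℝ, Integrable
        (fun x : EllipticalScale.Obs q m p =>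
          EllipticalScale.loss (EllipticalScale.sampleCov x)
            (a • EllipticalScale.sampleCov x) Sig)
        (EllipticalScale.law f θ Sig) ∧
      R a = a ^ 2 * K * r * v - 2 * a * r
        + ∫ x : EllipticalScale.Obs q m p,
            Matrix.trace (EllipticalScale.pinv (EllipticalScale.sampleCov x) * Sig)
            ∂(EllipticalScale.law f θ Sig) := by
    intro a
    have hae := EllipticalScale.loss_smul_sampleCov_ae_eq (m := m) f θ hSig a
    have hi1 : Integrable (fun x : EllipticalScale.Obs q m p =>
        a ^ 2 * Matrix.trace (Sig⁻¹ * EllipticalScale.sampleCov x)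
          - 2 * a * ((min p m : ℕ) : ℝ)) (EllipticalScale.law f θ Sig) :=
      (hS.const_mul (a ^ 2)).sub (integrable_const _)
    refine ⟨(integrable_congr hae).2 (hi1.add hSp'), ?_⟩
    rw [hR, EllipticalScale.risk, integral_congr_ae hae, integral_add hi1 hSp',
      integral_sub (hS.const_mul (a ^ 2)) (integrable_const _), integral_const_mul,
      EllipticalScale.integral_law_trace_inv_mul_sampleCov hf θ hSig, integral_const,
      probReal_univ, one_smul, ← hKdef, ← hr, hrv]
    push_cast
    ring
  have ha₀pos : 0 < a₀ := by rw [ha₀]; positivity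
  -- Completed square: minimality and uniqueness both follow from `K r v > 0`.
  have hdiff : ∀ a, R a = R a₀ + K * r * v * (a - a₀) ^ 2 := by
    intro a
    rw [(hmain a).2, (hmain a₀).2, ha₀]
    field_simp
    ring
  refine ⟨fun θ' Sig' hSig' => ?_, fun a _ => hmain a, hK0, ha₀pos, ?_, fun a _ hne => ?_⟩
  · rw [EllipticalScale.KStar_eq_lintegral_FStar_sumSq hf θ' hSig',
      EllipticalScale.KStar_eq_lintegral_FStar_sumSq hf θ hSig]
  · intro a _
    rw [Set.mem_ofPred_eq, hdiff a]
    exact le_add_of_nonneg_right (by positivity)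
  · rw [hdiff a]
    have := sq_pos_of_ne_zero (sub_ne_zero.2 hne)
    exact lt_add_of_pos_right _ (by positivity)
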